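/- Let $\phi(x)=1/(1+e^{-x})$ be the logistic function, let $\Omega=\mathbb{R}\times[0,1]$ with Lebesgue measure, and let $\mathcal{S}_2(\phi)$ be the set of all functions on $\mathbb{R}^2$ of the form $$x\mapsto\sum_{i=1}^{k}t_i\,\phi(\langle y_i,x\rangle+\theta_i),\qquad k\in\mathbb{N},\ t_i,\theta_i\in\mathbb{R},\ y_i\in\mathbb{R}^2 .$$ Fix $r\in\mathbb{R}$, $q\ge 0$ and $\sigma>0$. For $s>0$ and $0<\tau\le 1$ let $$f(s,\tau)=s e^{-q\tau}N(d_1)-e^{-r\tau}N(d_2),\qquad g(s,\tau)=f(s,\tau)-\max(0,\,s e^{-q\tau}-e^{-r\tau}),$$ where $$d_1=\frac{\log s+(r-q+\sigma^2/2)\tau}{\sigma\sqrt{\tau}},\qquad d_2=\frac{\log s+(r-q-\sigma^2/2)\tau}{\sigma\sqrt{\tau}},\qquad N(x)=\frac{1}{\sqrt{2\pi}}\int_{-\infty}^{x}e^{-t^2/2}\,dt .$$ At $\tau=0$ let $f$ and $g$ take their limiting values $f(s,0)=\max(0,s-1)$ and $g(s,0)=0$, and regard $f$ and $g$ as functions on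 $\Omega$ by setting them equal to $0$ for $s\le 0$. Then: 1. $g\in L^2(\Omega)$, and $g$ lies in the closure of $\mathcal{S}_2(\phi)\cap L^2(\Omega)$ in $L^2(\Omega)$. 2. There is no $\mathcal{N}\in\mathcal{S}_2(\phi)$ for which $\|\mathcal{N}-f\|_{L^2(\Omega)}$ is finite. -/

import Mathlib

open MeasureTheory Set

/-- The translate `ψ^{τ_θ} : x ↦ ψ (x + θ)` of a function `ψ` on the real line. -/
def realTranslate (θ : ℝ) (ψ : ℝ → ℝ) : ℝ → ℝ := fun x => ψ (x + θ)

/-- The ridge function `ψ^{δ_y} : x ↦ ψ ⟨y, x⟩` on `ℝⁿ`. -/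
noncomputable def ridgeFunction {n : ℕ} (y : EuclideanSpace ℝ (Fin n)) (ψ : ℝ → ℝ) :
    EuclideanSpace ℝ (Fin n) → ℝ := fun x => ψ (inner ℝ y x)

/-- `𝒮ₙ(ψ)`: the functions on `ℝⁿ` represented by shallow networks with activation `ψ`,
i.e. the finite sums `∑ᵢ tᵢ ψ(⟨yᵢ, x⟩ + θᵢ)`. The logistic activation is `Real.sigmoid`. -/
def shallowNetworks (n : ℕ) (ψ : ℝ → ℝ) : Set (EuclideanSpace ℝ (Fin n) → ℝ) :=
  {F | ∃ (k : ℕ) (t : Fin k → ℝ) (y : Fin k → EuclideanSpace ℝ (Fin n)) (θ : Fin k → ℝ),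
    F = ∑ i, t i • ridgeFunction (y i) (realTranslate (θ i) ψ)}

/-- The strip `Ω = ℝ × [0, 1]` in the Euclidean plane. -/
def strip : Set (EuclideanSpace ℝ (Fin 2)) := {x | x 1 ∈ Icc (0 : ℝ) 1}

/-- The standard normal distribution function `N(x)`. -/
noncomputable def normalCDF (x : ℝ) : ℝ :=
  1 / Real.sqrt (2 * Real.pi) * ∫ t in Iic x, Real.exp (-t ^ 2 / 2)

/-- `d₁` of the Black–Scholes formula. -/
noncomputable def bsD1 (σ r q s τ : ℝ) : ℝ :=
  (Real.log s + (r - q + σ ^ 2 / 2) * τ) / (σ * Real.sqrt τ)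

/-- `d₂` of the Black–Scholes formula. -/
noncomputable def bsD2 (σ r q s τ : ℝ) : ℝ :=
  (Real.log s + (r - q - σ ^ 2 / 2) * τ) / (σ * Real.sqrt τ)

/-- The normalized intrinsic value `(s e^{-qτ} - e^{-rτ})⁺`. -/
noncomputable def intrinsicValue (r q s τ : ℝ) : ℝ :=
  max 0 (s * Real.exp (-q * τ) - Real.exp (-r * τ))

/-- The normalized Black–Scholes price `f(s, τ) = s e^{-qτ} N(d₁) - e^{-rτ} N(d₂)` of a European
call, for `s > 0` and `0 < τ ≤ 1`. At maturity `τ = 0`, where `d₁` and `d₂` have a zero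
denominator, it takes its limiting value, the payoff `(s - 1)⁺`. -/
noncomputable def bsPrice (σ r q s τ : ℝ) : ℝ :=
  if τ = 0 then max 0 (s - 1)
  else s * Real.exp (-q * τ) * normalCDF (bsD1 σ r q s τ)
    - Real.exp (-r * τ) * normalCDF (bsD2 σ r q s τ)

/-- The normalized time value `g(s, τ) = f(s, τ) - (s e^{-qτ} - e^{-rτ})⁺`. -/
noncomputable def bsTimeValue (σ r q s τ : ℝ) : ℝ :=
  bsPrice σ r q s τ - intrinsicValue r q s τ

/-- A function of `(s, τ)` with `s > 0`, regarded as a function on the plane (in particular on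
`ℝ × [0, 1]`) through extension by zero to `s ≤ 0`. -/
noncomputable def extendByZero (u : ℝ → ℝ → ℝ) : EuclideanSpace ℝ (Fin 2) → ℝ :=
  {x : EuclideanSpace ℝ (Fin 2) | 0 < x 0}.indicator fun x => u (x 0) (x 1)

open Filter Topology
open scoped ContDiff

/-! The first claim holds for a general reason: square integrable logistic networks are dense in L²
of the strip (`networkSubmodule_topologicalClosure`). Let `h` be orthogonal to them. A logistic
ridge `sigmoid (l * (x + b * τ - c))` is not square integrable on the strip, but the difference of
two with the same `b` and `l` is. Letting `l → ∞` and superposing the resulting steps with density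
`χ'` gives `∫ h χ(x + bτ) = 0` for all test functions `χ` and all `b`. Differentiating `k` times in
`b` gives `∫ h τ^k χ^(k)(x + a) = 0`. The derivatives on `χ` can be removed: an integral `∫ h τ^k
u(x + a)` with zero derivative in `a` is constant, and the constant is zero because a translated
bump escapes the mass of an L² function (`eq_zero_of_integral_mul_translate_eq`). So almost every
slice `h(x, ·)` has vanishing moments on [0, 1], and Weierstrass approximation gives `h = 0`.

It remains that the time value is square integrable: it is `O(1 / (1 + s²))` uniformly in `τ`, by
Gaussian tails (`exists_abs_bsTimeValue_le`). Hence the price itself grows linearly in `s`, while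
every network is bounded; their difference is at least 1 on a set of infinite measure, which is the
second claim. -/

/-! ### Logistic functions, unit steps and exponential decay -/

theorem integrable_exp_neg_abs : Integrable (fun x : ℝ => Real.exp (-|x|)) := by
  refine (integrable_inv_one_add_sq.const_mul 2).mono' (by fun_prop) (ae_of_all _ fun x => ?_)
  have h := Real.quadratic_le_exp_of_nonneg (abs_nonneg x)
  rw [Real.norm_of_nonneg (Real.exp_pos _).le, Real.exp_neg, ← div_eq_mul_inv,
    inv_le_comm₀ (Real.exp_pos _) (by positivity), inv_div, div_le_iff₀ two_pos]
  have := sq_abs x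
  nlinarith [abs_nonneg x]

theorem Real.sigmoid_le_exp (x : ℝ) : Real.sigmoid x ≤ Real.exp x := by
  rw [Real.sigmoid_def, inv_le_comm₀ (by positivity) (Real.exp_pos x), ← Real.exp_neg]
  linarith

/-- For `|x| ≥ R` both values lie within `exp (R - |x|)` of the same limit, 0 or 1; for `|x| ≤ R`
the bound is at least 1. Uniformity in `l` makes it a dominating function for `l → ∞`. -/
theorem abs_sigmoid_sub_sigmoid_le {c d R l x : ℝ} (hc : |c| ≤ R) (hd : |d| ≤ R) (hl : 1 ≤ l) :
    |Real.sigmoid (l * (x - c)) - Real.sigmoid (l * (x - d))| ≤ Real.exp R * Real.exp (-|x|) := by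
  rw [← Real.exp_add]
  have hc' := abs_le.1 hc
  have hd' := abs_le.1 hd
  have key : ∀ z, -R ≤ z → z ≤ R → x ≤ -R →
      0 < Real.sigmoid (l * (x - z)) ∧ Real.sigmoid (l * (x - z)) ≤ Real.exp (R + x) := by
    intro z hz _ hx
    refine ⟨Real.sigmoid_pos _, (Real.sigmoid_le_exp _).trans (Real.exp_le_exp.2 ?_)⟩
    nlinarith
  have key' : ∀ z, -R ≤ z → z ≤ R → R ≤ x →
      1 - Real.exp (R - x) ≤ Real.sigmoid (l * (x - z)) ∧ Real.sigmoid (l * (x - z)) < 1 := by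
    intro z _ hz hx
    refine ⟨?_, Real.sigmoid_lt_one _⟩
    have h := Real.sigmoid_le_exp (-(l * (x - z)))
    rw [Real.sigmoid_neg] at h
    have : Real.exp (-(l * (x - z))) ≤ Real.exp (R - x) := Real.exp_le_exp.2 (by nlinarith)
    linarith
  rcases le_total x (-R) with hx | hx
  · rw [abs_of_nonpos (by linarith [abs_nonneg c] : x ≤ 0), neg_neg, abs_le]
    have h1 := key c hc'.1 hc'.2 hx
    have h2 := key d hd'.1 hd'.2 hx
    constructor <;> linarith [h1.1, h1.2, h2.1, h2.2]
  rcases le_total R x with hx' | hx'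
  · rw [abs_of_nonneg (by linarith [abs_nonneg c] : 0 ≤ x), ← sub_eq_add_neg, abs_le]
    have h1 := key' c hc'.1 hc'.2 hx'
    have h2 := key' d hd'.1 hd'.2 hx'
    constructor <;> linarith [h1.1, h1.2, h2.1, h2.2]
  · have h1 : (1 : ℝ) ≤ Real.exp (R + -|x|) := by
      rw [Real.one_le_exp_iff]
      linarith [abs_le.2 ⟨hx, hx'⟩]
    refine le_trans (abs_le.2 ⟨?_, ?_⟩) h1 <;>
      linarith [Real.sigmoid_pos (l * (x - c)), Real.sigmoid_lt_one (l * (x - c)),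
        Real.sigmoid_pos (l * (x - d)), Real.sigmoid_lt_one (l * (x - d))]

/-- The pointwise limit of steep logistic functions: the unit step, with value `1 / 2` at `0`. -/
noncomputable def unitStep (x : ℝ) : ℝ := if x < 0 then 0 else if x = 0 then 1 / 2 else 1

theorem measurable_unitStep : Measurable unitStep :=
  Measurable.ite measurableSet_Iio measurable_const
    (Measurable.ite (measurableSet_singleton 0) measurable_const measurable_const)

theorem tendsto_sigmoid_mul_unitStep (x : ℝ) :
    Tendsto (fun l : ℝ => Real.sigmoid (l * x)) atTop (𝓝 (unitStep x)) := by
  rcases lt_trichotomy x 0 with h | rfl | h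
  · simp only [unitStep, h, if_true]
    exact Real.tendsto_sigmoid_atBot.comp (tendsto_id.atTop_mul_const_of_neg h)
  · simp [unitStep, Real.sigmoid_zero]
  · simp only [unitStep, h.not_gt, h.ne', if_false]
    exact Real.tendsto_sigmoid_atTop.comp (tendsto_id.atTop_mul_const h)

theorem abs_unitStep_sub_unitStep_le {c d R x : ℝ} (hc : |c| ≤ R) (hd : |d| ≤ R) :
    |unitStep (x - c) - unitStep (x - d)| ≤ Real.exp R * Real.exp (-|x|) := by
  refine le_of_tendsto
    (((tendsto_sigmoid_mul_unitStep (x - c)).sub (tendsto_sigmoid_mul_unitStep (x - d))).abs) ?_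
  filter_upwards [eventually_ge_atTop 1] with l hl using abs_sigmoid_sub_sigmoid_le hc hd hl

theorem exp_neg_abs_add_le (x y : ℝ) :
    Real.exp (-|x + y|) ≤ Real.exp |y| * Real.exp (-|x|) := by
  rw [← Real.exp_add, Real.exp_le_exp]
  have := abs_sub (x + y) y
  rw [add_sub_cancel_right] at this
  linarith

theorem exists_le_exp_neg_abs {u : ℝ → ℝ} (hu : Continuous u) (hc : HasCompactSupport u) :
    ∃ C, 0 ≤ C ∧ ∀ x, |u x| ≤ C * Real.exp (-|x|) := by
  have h1 : Continuous fun x => u x * Real.exp |x| := by fun_prop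
  obtain ⟨C, hC⟩ := h1.bounded_above_of_compact_support (hc.mul_right)
  refine ⟨C, (norm_nonneg _).trans (hC 0), fun x => ?_⟩
  have := hC x
  rw [norm_mul, Real.norm_eq_abs, Real.norm_of_nonneg (Real.exp_pos _).le] at this
  rwa [Real.exp_neg, ← div_eq_mul_inv, le_div_iff₀ (Real.exp_pos _)]

/-- The reference step at `y` costs nothing, since `∫ χ' = 0`, but it makes the integrand decay in
`x`, which Fubini needs later. -/
theorem integral_deriv_mul_unitStep {χ : ℝ → ℝ} (hχ : ContDiff ℝ 1 χ) (hc : HasCompactSupport χ)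
    (x y : ℝ) : ∫ t, deriv χ t * (unitStep (x - t) - unitStep (x - y)) = χ x := by
  have hint : Integrable (deriv χ) :=
    (hχ.continuous_deriv le_rfl).integrable_of_hasCompactSupport hc.deriv
  have h0 : ∫ t, deriv χ t = 0 :=
    integral_eq_zero_of_hasDerivAt_of_integrable
      (fun t => (hχ.differentiable one_ne_zero t).hasDerivAt) hint
      (hχ.continuous.integrable_of_hasCompactSupport hc)
  have h1 : (fun t => deriv χ t * unitStep (x - t)) =ᵐ[volume] (Iic x).indicator (deriv χ) := by
    have : ∀ᵐ t : ℝ, t ≠ x := by simp [ae_iff]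
    filter_upwards [this] with t ht
    rcases lt_or_gt_of_ne ht with h | h
    · simp [unitStep, h.le, h.not_gt, sub_eq_zero, ht.symm]
    · simp [unitStep, h, h.not_ge]
  have h1i : Integrable fun t => deriv χ t * unitStep (x - t) :=
    (integrable_congr h1).2 (hint.indicator measurableSet_Iic)
  simp only [mul_sub]
  rw [integral_sub h1i (hint.mul_const _), integral_mul_const, h0, zero_mul, sub_zero,
    integral_congr_ae h1, integral_indicator measurableSet_Iic, hc.integral_Iic_deriv_eq hχ]

/-! ### Orthogonality and differentiation under an exponential weight -/

section ExponentialWeight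

variable {α : Type*} [MeasurableSpace α] {μ : Measure α} {w X v : α → ℝ}

theorem integrable_mul_comp_of_le_exp_neg_abs (hw : AEStronglyMeasurable w μ) (hX : Measurable X)
    (hi : Integrable (fun p => w p * Real.exp (-|X p|)) μ) {u : ℝ → ℝ} (hu : Measurable u) {C : ℝ}
    (hC : ∀ x, |u x| ≤ C * Real.exp (-|x|)) : Integrable (fun p => w p * u (X p)) μ := by
  refine (hi.norm.const_mul C).mono'
    (hw.mul (hu.comp hX).aestronglyMeasurable) (ae_of_all _ fun p => ?_)
  have := mul_le_mul_of_nonneg_left (hC (X p)) (norm_nonneg (w p))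
  rw [norm_mul, norm_mul, Real.norm_of_nonneg (Real.exp_pos _).le]
  calc ‖w p‖ * ‖u (X p)‖ ≤ _ := this
    _ = _ := by ring

theorem integrable_mul_comp_of_hasCompactSupport (hw : AEStronglyMeasurable w μ)
    (hX : Measurable X) (hi : Integrable (fun p => w p * Real.exp (-|X p|)) μ) {u : ℝ → ℝ}
    (hu : Continuous u) (hc : HasCompactSupport u) : Integrable (fun p => w p * u (X p)) μ := by
  obtain ⟨C, -, hC⟩ := exists_le_exp_neg_abs hu hc
  exact integrable_mul_comp_of_le_exp_neg_abs hw hX hi hu.measurable hC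

theorem integrable_mul_exp_neg_abs_add (hw : AEStronglyMeasurable w μ) (hX : Measurable X)
    (hv : Measurable v) (hi : Integrable (fun p => w p * Real.exp (-|X p|)) μ) {K : ℝ}
    (hK : ∀ᵐ p ∂μ, |v p| ≤ K) : Integrable (fun p => w p * Real.exp (-|X p + v p|)) μ := by
  refine (hi.norm.const_mul (Real.exp K)).mono' (hw.mul (by fun_prop)) ?_
  filter_upwards [hK] with p hp
  have h1 := (exp_neg_abs_add_le (X p) (v p)).trans
    (mul_le_mul_of_nonneg_right (Real.exp_le_exp.2 hp) (Real.exp_pos (-|X p|)).le)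
  have := mul_le_mul_of_nonneg_left h1 (norm_nonneg (w p))
  rw [norm_mul, norm_mul, Real.norm_of_nonneg (Real.exp_pos _).le,
    Real.norm_of_nonneg (Real.exp_pos _).le]
  calc _ ≤ _ := this
    _ = _ := by ring

theorem integral_mul_unitStep_sub_eq_zero (hw : AEStronglyMeasurable w μ) (hX : Measurable X)
    (hi : Integrable (fun p => w p * Real.exp (-|X p|)) μ) {c d : ℝ}
    (h : ∀ l : ℝ, 1 ≤ l →
      ∫ p, w p * (Real.sigmoid (l * (X p - c)) - Real.sigmoid (l * (X p - d))) ∂μ = 0) :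
    ∫ p, w p * (unitStep (X p - c) - unitStep (X p - d)) ∂μ = 0 := by
  set R := max |c| |d|
  refine tendsto_nhds_unique (tendsto_integral_filter_of_dominated_convergence
    (F := fun (l : ℝ) p => w p * (Real.sigmoid (l * (X p - c)) - Real.sigmoid (l * (X p - d))))
    (l := atTop)
    (fun p => Real.exp R * ‖w p * Real.exp (-|X p|)‖) ?_ ?_ (hi.norm.const_mul _) ?_) ?_
  · refine Eventually.of_forall fun l => hw.mul (Measurable.aestronglyMeasurable ?_)
    have := continuous_sigmoid.measurable
    fun_prop
  · filter_upwards [eventually_ge_atTop 1] with l hl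
    refine ae_of_all _ fun p => ?_
    have := mul_le_mul_of_nonneg_left (abs_sigmoid_sub_sigmoid_le (x := X p) (le_max_left |c| |d|)
      (le_max_right |c| |d|) hl) (norm_nonneg (w p))
    rw [norm_mul, norm_mul, Real.norm_of_nonneg (Real.exp_pos _).le]
    calc _ ≤ _ := this
      _ = _ := by ring
  · exact ae_of_all _ fun p => ((tendsto_sigmoid_mul_unitStep _).sub
      (tendsto_sigmoid_mul_unitStep _)).const_mul _
  · refine tendsto_const_nhds.congr' ?_
    filter_upwards [eventually_ge_atTop 1] with l hl using (h l hl).symm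

/-- `χ` is a superposition of step differences with density `χ'`; Fubini exchanges the superposition
with the integral against `w`. -/
theorem integral_mul_comp_eq_zero_of_unitStep [SFinite μ] (hw : AEStronglyMeasurable w μ)
    (hX : Measurable X) (hi : Integrable (fun p => w p * Real.exp (-|X p|)) μ)
    (h : ∀ c d : ℝ, ∫ p, w p * (unitStep (X p - c) - unitStep (X p - d)) ∂μ = 0)
    {χ : ℝ → ℝ} (hχ : ContDiff ℝ 1 χ) (hc : HasCompactSupport χ) :
    ∫ p, w p * χ (X p) ∂μ = 0 := by
  have hcd : Continuous (deriv χ) := hχ.continuous_deriv le_rfl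
  obtain ⟨R, hR⟩ : ∃ R : ℝ, ∀ t, deriv χ t ≠ 0 → |t| ≤ R := by
    obtain ⟨R, hR⟩ := hc.deriv.isCompact.isBounded.exists_norm_le
    exact ⟨R, fun t ht => hR t (subset_tsupport _ ht)⟩
  -- All jumps `t` with `χ' t ≠ 0`, and the reference jump `R`, lie in `[-|R|, |R|]`, so a single
  -- constant `exp |R|` dominates.
  have hprod : Integrable (Function.uncurry fun p t =>
      w p * (deriv χ t * (unitStep (X p - t) - unitStep (X p - R)))) (μ.prod volume) := by
    refine ((hi.norm.mul_prod
      ((hcd.integrable_of_hasCompactSupport hc.deriv).norm)).const_mul (Real.exp |R|)).mono' ?_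
      (ae_of_all _ fun ⟨p, t⟩ => ?_)
    · refine hw.comp_fst.mul (Measurable.aestronglyMeasurable ?_)
      have := hcd.measurable
      have := measurable_unitStep
      fun_prop
    · simp only [Function.uncurry]
      by_cases ht : deriv χ t = 0
      · simp [ht]
      · have h1 := abs_unitStep_sub_unitStep_le (x := X p) ((hR t ht).trans (le_abs_self R)) le_rfl
        have := mul_le_mul_of_nonneg_left h1 (mul_nonneg (norm_nonneg (w p)) (norm_nonneg (deriv χ t)))
        rw [norm_mul, norm_mul, norm_mul, Real.norm_of_nonneg (Real.exp_pos _).le, ← mul_assoc]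
        calc _ ≤ _ := this
          _ = _ := by ring
  calc ∫ p, w p * χ (X p) ∂μ
      = ∫ p, (∫ t, w p * (deriv χ t * (unitStep (X p - t) - unitStep (X p - R)))) ∂μ := by
        simp only [integral_const_mul, integral_deriv_mul_unitStep hχ hc]
    _ = ∫ t, (∫ p, w p * (deriv χ t * (unitStep (X p - t) - unitStep (X p - R))) ∂μ) :=
        integral_integral_swap hprod
    _ = 0 := by
        simp only [mul_left_comm (w _), integral_const_mul, h, mul_zero, integral_zero]

/-- For `b` within 1 of `a`, the shift `b * v` is at most `|a| + 1`, which costs only a constant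
factor in the exponential bound on `deriv u`. -/
theorem hasDerivAt_integral_mul_comp_add_mul (hw : AEStronglyMeasurable w μ) (hX : Measurable X)
    (hv : Measurable v) (hv1 : ∀ᵐ p ∂μ, |v p| ≤ 1)
    (hi : Integrable (fun p => w p * Real.exp (-|X p|)) μ)
    {u : ℝ → ℝ} (hu : ContDiff ℝ 1 u) (hc : HasCompactSupport u) (a : ℝ) :
    HasDerivAt (fun a => ∫ p, w p * u (X p + a * v p) ∂μ)
      (∫ p, w p * v p * deriv u (X p + a * v p) ∂μ) a := by
  have hcd : Continuous (deriv u) := hu.continuous_deriv le_rfl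
  have hbd : ∀ a b : ℝ, |a - b| < 1 → ∀ᵐ p ∂μ, |a * v p| ≤ |b| + 1 := by
    intro a b hab
    filter_upwards [hv1] with p hp
    rw [abs_mul]
    have : |a| ≤ |b| + 1 := by linarith [abs_sub_abs_le_abs_sub a b]
    nlinarith [abs_nonneg a, abs_nonneg (v p)]
  obtain ⟨C, hC0, hC⟩ := exists_le_exp_neg_abs hcd hc.deriv
  refine (hasDerivAt_integral_of_dominated_loc_of_deriv_le
    (bound := fun p => C * Real.exp (|a| + 1) * ‖w p * Real.exp (-|X p|)‖)
    (F' := fun a p => w p * v p * deriv u (X p + a * v p))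
    (Metric.ball_mem_nhds a one_pos) ?_ ?_ ?_ ?_ (hi.norm.const_mul _) ?_).2
  · have := hu.continuous.measurable
    exact Eventually.of_forall fun b => hw.mul (Measurable.aestronglyMeasurable (by fun_prop))
  · refine integrable_mul_comp_of_hasCompactSupport hw (by fun_prop) ?_ hu.continuous hc
    exact integrable_mul_exp_neg_abs_add hw hX (by fun_prop) hi (hbd a a (by simp))
  · have := hcd.measurable
    exact (hw.mul hv.aestronglyMeasurable).mul (Measurable.aestronglyMeasurable (by fun_prop))
  · filter_upwards [hv1] with p hp b hb
    have hb' : |b * v p| ≤ |a| + 1 := by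
      rw [abs_mul]
      have : |b| ≤ |a| + 1 := by
        have : |b - a| < 1 := hb
        linarith [abs_sub_abs_le_abs_sub b a]
      nlinarith [abs_nonneg b, abs_nonneg (v p)]
    have h1 : |deriv u (X p + b * v p)| ≤ C * (Real.exp (|a| + 1) * Real.exp (-|X p|)) :=
      (hC _).trans (mul_le_mul_of_nonneg_left ((exp_neg_abs_add_le _ _).trans
        (mul_le_mul_of_nonneg_right (Real.exp_le_exp.2 hb') (Real.exp_pos _).le)) hC0)
    rw [norm_mul, norm_mul, norm_mul, Real.norm_of_nonneg (Real.exp_pos _).le]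
    calc ‖w p‖ * ‖v p‖ * ‖deriv u (X p + b * v p)‖
        ≤ ‖w p‖ * 1 * (C * (Real.exp (|a| + 1) * Real.exp (-|X p|))) := by
          gcongr
          · exact hp
          · exact h1
      _ = _ := by ring
  · refine ae_of_all _ fun p b _ => ?_
    have h1 := (hu.differentiable one_ne_zero (X p + b * v p)).hasDerivAt
    have h2 : HasDerivAt (fun b => X p + b * v p) (v p) b := by
      simpa using ((hasDerivAt_id b).mul_const (v p)).const_add (X p)
    have := (h1.comp b h2).const_mul (w p)
    exact this.congr_deriv (by ring)

end ExponentialWeight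

/-! ### The strip: from ridge integrals to vanishing moments -/

/-- Lebesgue measure on the strip `ℝ × [0, 1]`, as a measure on `ℝ × ℝ`. -/
noncomputable def stripMeasure : Measure (ℝ × ℝ) :=
  (volume : Measure ℝ).prod (volume.restrict (Icc (0 : ℝ) 1))

instance : IsProbabilityMeasure (volume.restrict (Icc (0 : ℝ) 1)) := ⟨by simp⟩

instance : SigmaFinite stripMeasure := by unfold stripMeasure; infer_instance

theorem ae_stripMeasure_snd_mem : ∀ᵐ p ∂stripMeasure, p.2 ∈ Icc (0 : ℝ) 1 :=
  Measure.quasiMeasurePreserving_snd.ae (ae_restrict_mem measurableSet_Icc)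

theorem integrable_comp_fst_stripMeasure {u : ℝ → ℝ} (hu : Integrable u) :
    Integrable (fun p : ℝ × ℝ => u p.1) stripMeasure :=
  hu.comp_fst _

theorem integral_comp_fst_stripMeasure (u : ℝ → ℝ) :
    ∫ p, u p.1 ∂stripMeasure = ∫ x, u x := by
  rw [stripMeasure, integral_fun_fst]
  simp

theorem memLp_exp_neg_abs_fst :
    MemLp (fun p : ℝ × ℝ => Real.exp (-|p.1|)) 2 stripMeasure := by
  rw [memLp_two_iff_integrable_sq (by fun_prop)]
  refine (integrable_comp_fst_stripMeasure integrable_exp_neg_abs).mono' (by fun_prop)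
    (ae_of_all _ fun p => ?_)
  rw [Real.norm_of_nonneg (by positivity), sq]
  exact mul_le_of_le_one_left (Real.exp_pos _).le (Real.exp_le_one_iff.2 (by simp))

theorem MeasureTheory.MemLp.integrable_mul_exp_neg_abs_fst {w : ℝ × ℝ → ℝ}
    (hw : MemLp w 2 stripMeasure) :
    Integrable (fun p => w p * Real.exp (-|p.1|)) stripMeasure :=
  hw.integrable_mul memLp_exp_neg_abs_fst

theorem MeasureTheory.MemLp.mul_snd_pow {w : ℝ × ℝ → ℝ} (hw : MemLp w 2 stripMeasure) (k : ℕ) :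
    MemLp (fun p => w p * p.2 ^ k) 2 stripMeasure := by
  refine hw.mono (hw.1.mul (by fun_prop)) ?_
  filter_upwards [ae_stripMeasure_snd_mem] with p hp
  rw [norm_mul, norm_pow, Real.norm_of_nonneg hp.1]
  exact mul_le_of_le_one_right (norm_nonneg _) (pow_le_one₀ hp.1 hp.2)

/-- Translates of `u` tend weakly to zero: the window carrying the translate eventually leaves any
fixed part of the mass of `w²`. -/
theorem eq_zero_of_integral_mul_translate_eq {w : ℝ × ℝ → ℝ} (hw : MemLp w 2 stripMeasure)
    {u : ℝ → ℝ} (hu : Continuous u) (hc : HasCompactSupport u) {c₀ : ℝ}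
    (h : ∀ a, ∫ p, w p * u (p.1 + a) ∂stripMeasure = c₀) : c₀ = 0 := by
  have hw2 : Integrable (fun p => w p ^ 2) stripMeasure := hw.integrable_sq
  have hu2 : Integrable (fun x => u x ^ 2) := by
    simp only [sq]
    exact (hu.mul hu).integrable_of_hasCompactSupport hc.mul_left
  obtain ⟨R, hR⟩ : ∃ R : ℝ, ∀ t, u t ≠ 0 → |t| ≤ R := by
    obtain ⟨R, hR⟩ := hc.isCompact.isBounded.exists_norm_le
    exact ⟨R, fun t ht => hR t (subset_tsupport _ ht)⟩
  let A : ℝ → Set (ℝ × ℝ) := fun a => {p | |p.1 + a| ≤ R}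
  have hA : ∀ a, MeasurableSet (A a) := fun a => measurableSet_le (by fun_prop) measurable_const
  have hlim : Tendsto (fun a => ∫ p, (A a).indicator (fun p => w p ^ 2) p ∂stripMeasure)
      atTop (𝓝 0) := by
    rw [← integral_zero (ℝ × ℝ) ℝ (μ := stripMeasure)]
    refine tendsto_integral_filter_of_dominated_convergence (fun p => w p ^ 2)
      (Eventually.of_forall fun a => hw2.1.indicator (hA a))
      (Eventually.of_forall fun a => ae_of_all _ fun p => ?_) hw2 (ae_of_all _ fun p => ?_)
    · rw [Real.norm_of_nonneg (indicator_nonneg (fun _ _ => sq_nonneg _) _)]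
      exact indicator_le_self' (fun _ _ => sq_nonneg _) _
    · refine tendsto_const_nhds.congr' ?_
      filter_upwards [eventually_gt_atTop (R - p.1)] with a ha
      rw [indicator_of_notMem]
      intro hp
      have := (abs_le.1 (show |p.1 + a| ≤ R from hp)).2
      linarith
  -- Young's inequality `2|w u| ≤ δ⁻¹ w² + δ u²` on the window `A a`. As `a → ∞` the first term
  -- vanishes, while the integral of the second does not depend on `a`; then `δ → 0`.
  have hbound : ∀ δ : ℝ, 0 < δ → 2 * |c₀| ≤ δ * ∫ x, u x ^ 2 := by
    intro δ hδ
    have hlim' := (hlim.const_mul δ⁻¹).add_const (δ * ∫ x, u x ^ 2)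
    rw [mul_zero, zero_add] at hlim'
    refine ge_of_tendsto' hlim' fun a => ?_
    have hu2a : Integrable (fun p : ℝ × ℝ => u (p.1 + a) ^ 2) stripMeasure :=
      integrable_comp_fst_stripMeasure (hu2.comp_add_right a)
    have hint : ∫ p : ℝ × ℝ, u (p.1 + a) ^ 2 ∂stripMeasure = ∫ x, u x ^ 2 := by
      rw [integral_comp_fst_stripMeasure (fun x => u (x + a) ^ 2)]
      exact integral_add_right_eq_self (fun x => u x ^ 2) a
    rw [← hint, ← integral_const_mul, ← integral_const_mul, ← integral_add
      ((hw2.indicator (hA a)).const_mul _) (hu2a.const_mul _), ← h a, ← Real.norm_eq_abs,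
      ← Real.norm_of_nonneg (zero_le_two (α := ℝ)), ← norm_mul, ← integral_const_mul]
    refine norm_integral_le_of_norm_le (((hw2.indicator (hA a)).const_mul _).add
      (hu2a.const_mul _)) (ae_of_all _ fun p => ?_)
    by_cases hp : p ∈ A a
    · rw [indicator_of_mem hp, Real.norm_eq_abs]
      have hδ' : δ * δ⁻¹ = 1 := mul_inv_cancel₀ hδ.ne'
      have h1 := mul_nonneg hδ.le (sq_nonneg (δ⁻¹ * w p - u (p.1 + a)))
      have h2 := mul_nonneg hδ.le (sq_nonneg (δ⁻¹ * w p + u (p.1 + a)))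
      have e1 : δ * (δ⁻¹ * w p - u (p.1 + a)) ^ 2 =
        δ⁻¹ * w p ^ 2 + δ * u (p.1 + a) ^ 2 - 2 * (w p * u (p.1 + a)) := by
        field_simp
        ring
      have e2 : δ * (δ⁻¹ * w p + u (p.1 + a)) ^ 2 =
        δ⁻¹ * w p ^ 2 + δ * u (p.1 + a) ^ 2 + 2 * (w p * u (p.1 + a)) := by
        field_simp
        ring
      rw [abs_le]
      constructor <;> linarith
    · have : u (p.1 + a) = 0 := by
        by_contra hne
        exact hp (hR _ hne)
      simp [indicator_of_notMem hp, this]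
  have h0 : Tendsto (fun δ : ℝ => δ * ∫ x, u x ^ 2) (𝓝[>] 0) (𝓝 0) := by
    have : Tendsto (fun δ : ℝ => δ * ∫ x, u x ^ 2) (𝓝 0) (𝓝 (0 * ∫ x, u x ^ 2)) :=
      tendsto_id.mul_const _
    rw [zero_mul] at this
    exact this.mono_left nhdsWithin_le_nhds
  have : 2 * |c₀| ≤ 0 := ge_of_tendsto h0 (by
    filter_upwards [self_mem_nhdsWithin] with δ hδ using hbound δ hδ)
  exact abs_eq_zero.1 (le_antisymm (by linarith) (abs_nonneg _))

theorem integral_mul_eq_zero_of_integral_mul_deriv_eq_zero {w : ℝ × ℝ → ℝ}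
    (hw : MemLp w 2 stripMeasure) {u : ℝ → ℝ} (hu : ContDiff ℝ 1 u) (hc : HasCompactSupport u)
    (h : ∀ a, ∫ p, w p * deriv u (p.1 + a) ∂stripMeasure = 0) (a : ℝ) :
    ∫ p, w p * u (p.1 + a) ∂stripMeasure = 0 := by
  have hd : ∀ a, HasDerivAt (fun a => ∫ p, w p * u (p.1 + a) ∂stripMeasure) 0 a := by
    intro a
    simpa [h] using hasDerivAt_integral_mul_comp_add_mul (v := fun _ => (1 : ℝ)) hw.1
      measurable_fst measurable_const (by simp) hw.integrable_mul_exp_neg_abs_fst hu hc a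
  refine eq_zero_of_integral_mul_translate_eq hw hu.continuous hc fun b => ?_
  exact is_const_of_deriv_eq_zero (fun a => (hd a).differentiableAt) (fun a => (hd a).deriv) b a

theorem integral_mul_pow_mul_eq_zero {h : ℝ × ℝ → ℝ} (hh : MemLp h 2 stripMeasure)
    (H : ∀ χ : ℝ → ℝ, ContDiff ℝ ∞ χ → HasCompactSupport χ → ∀ b : ℝ,
      ∫ p, h p * χ (p.1 + b * p.2) ∂stripMeasure = 0)
    (k : ℕ) {χ : ℝ → ℝ} (hχ : ContDiff ℝ ∞ χ) (hc : HasCompactSupport χ) :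
    ∫ p, h p * p.2 ^ k * χ p.1 ∂stripMeasure = 0 := by
  have hD : ∀ n : ℕ, ∀ u : ℝ → ℝ, ContDiff ℝ ∞ u → HasCompactSupport u →
      ContDiff ℝ ∞ (iteratedDeriv n u) ∧ HasCompactSupport (iteratedDeriv n u) := by
    intro n u hu huc
    induction n with
    | zero => simpa using ⟨hu, huc⟩
    | succ n ih =>
      rw [iteratedDeriv_succ]
      exact ⟨(contDiff_infty_iff_deriv.1 ih.1).2, ih.2.deriv⟩
  -- Each derivative in `b` brings down one factor `τ` and puts one derivative on `u`.
  have up : ∀ n : ℕ, ∀ u : ℝ → ℝ, ContDiff ℝ ∞ u → HasCompactSupport u → ∀ b : ℝ,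
      ∫ p, h p * p.2 ^ n * iteratedDeriv n u (p.1 + b * p.2) ∂stripMeasure = 0 := by
    intro n u hu huc
    induction n with
    | zero => simpa using H u hu huc
    | succ n ih =>
      intro b
      have h1 := hasDerivAt_integral_mul_comp_add_mul (v := fun p : ℝ × ℝ => p.2)
        (hh.mul_snd_pow n).1 measurable_fst measurable_snd
        (by filter_upwards [ae_stripMeasure_snd_mem] with p hp
            rw [abs_of_nonneg hp.1]
            exact hp.2)
        (hh.mul_snd_pow n).integrable_mul_exp_neg_abs_fst
        ((hD n u hu huc).1.of_le (by simp)) (hD n u hu huc).2 b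
      simp only [ih] at h1
      simpa only [iteratedDeriv_succ, pow_succ, mul_assoc] using
        h1.unique (hasDerivAt_const b (0 : ℝ))
  -- The power `τ^k` stays fixed while the derivatives on `χ` are removed one at a time; `n` counts
  -- those removed.
  have down : ∀ n m : ℕ, m + n = k → ∀ a : ℝ,
      ∫ p, h p * p.2 ^ k * iteratedDeriv m χ (p.1 + a) ∂stripMeasure = 0 := by
    intro n
    induction n with
    | zero =>
      rintro m rfl a
      -- A translate of `χ` is again a test function, so `b = 0` suffices and the shift `a` is free.
      have := up m (fun x => χ (x + a)) (hχ.comp (by fun_prop)) (hc.comp_homeomorph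
        (Homeomorph.addRight a)) 0
      simpa [iteratedDeriv_comp_add_const] using this
    | succ n ih =>
      intro m hm a
      refine integral_mul_eq_zero_of_integral_mul_deriv_eq_zero (hh.mul_snd_pow k)
        ((hD m χ hχ hc).1.of_le (by simp)) (hD m χ hχ hc).2 (fun a => ?_) a
      rw [← iteratedDeriv_succ]
      exact ih (m + 1) (by omega) a
  simpa using down k 0 (zero_add k) 0

/-- By Weierstrass, `f` is orthogonal to every smooth test function once it is orthogonal to
polynomials. -/
theorem ae_eq_zero_of_integral_mul_pow_eq_zero {f : ℝ → ℝ}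
    (hf : IntegrableOn f (Icc 0 1)) (h : ∀ k : ℕ, ∫ x in Icc (0 : ℝ) 1, f x * x ^ k = 0) :
    f =ᵐ[volume.restrict (Icc 0 1)] 0 := by
  have hpoly : ∀ P : Polynomial ℝ, ∫ x in Icc (0 : ℝ) 1, f x * P.eval x = 0 := by
    intro P
    simp only [Polynomial.eval_eq_sum_range, Finset.mul_sum]
    have hcont : ∀ k : ℕ, IntegrableOn (fun x => f x * x ^ k) (Icc 0 1) := fun k =>
      hf.mul_continuousOn (by fun_prop) isCompact_Icc
    rw [integral_finsetSum]
    · refine Finset.sum_eq_zero fun k _ => ?_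
      simp only [mul_left_comm (f _), integral_const_mul, h, mul_zero]
    · intro k _
      simp only [mul_left_comm (f _)]
      exact (hcont k).const_mul _
  have hind : LocallyIntegrable ((Icc (0 : ℝ) 1).indicator f) :=
    (hf.integrable_indicator measurableSet_Icc).locallyIntegrable
  have key := ae_eq_zero_of_integral_contDiff_smul_eq_zero hind fun g hg hgc => ?_
  · rw [Filter.EventuallyEq, ae_restrict_iff' measurableSet_Icc]
    filter_upwards [key] with x hx hxm
    simpa [hxm] using hx
  · have e : (fun x => g x • (Icc (0 : ℝ) 1).indicator f x) =
        (Icc (0 : ℝ) 1).indicator fun x => f x * g x := by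
      ext x
      by_cases hx : x ∈ Icc (0 : ℝ) 1 <;> simp [hx, mul_comm]
    rw [e, integral_indicator measurableSet_Icc]
    set I := ∫ x in Icc (0 : ℝ) 1, |f x|
    have hI : 0 ≤ I := integral_nonneg fun _ => abs_nonneg _
    have hb : ∀ ε : ℝ, 0 < ε → |∫ x in Icc (0 : ℝ) 1, f x * g x| ≤ ε * I := by
      intro ε hε
      obtain ⟨P, hP⟩ := exists_polynomial_near_of_continuousOn 0 1 g hg.continuous.continuousOn ε hε
      have h1 : ∫ x in Icc (0 : ℝ) 1, f x * g x
          = ∫ x in Icc (0 : ℝ) 1, f x * (g x - P.eval x) := by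
        simp only [mul_sub]
        rw [integral_sub, hpoly, sub_zero]
        · exact hf.mul_continuousOn hg.continuous.continuousOn isCompact_Icc
        · exact hf.mul_continuousOn P.continuous.continuousOn isCompact_Icc
      rw [h1, ← integral_const_mul, ← Real.norm_eq_abs]
      refine norm_integral_le_of_norm_le (hf.abs.const_mul ε) ?_
      filter_upwards [ae_restrict_mem measurableSet_Icc] with x hx
      rw [norm_mul, mul_comm]
      refine mul_le_mul_of_nonneg_right ?_ (abs_nonneg _)
      rw [Real.norm_eq_abs, abs_sub_comm]
      exact (hP x hx).le
    by_contra hne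
    have hpos := abs_pos.2 hne
    -- With this `ε`, the bound `ε * I` is below half the integral; `I + 1` avoids division by zero.
    have := hb (|∫ x in Icc (0 : ℝ) 1, f x * g x| / (2 * (I + 1))) (by positivity)
    rw [div_mul_eq_mul_div, le_div_iff₀ (by positivity)] at this
    nlinarith

theorem ae_eq_zero_of_integral_mul_pow_mul_eq_zero {h : ℝ × ℝ → ℝ} (hh : MemLp h 2 stripMeasure)
    (H : ∀ (k : ℕ) (χ : ℝ → ℝ), ContDiff ℝ ∞ χ → HasCompactSupport χ →
      ∫ p, h p * p.2 ^ k * χ p.1 ∂stripMeasure = 0) :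
    h =ᵐ[stripMeasure] 0 := by
  -- The weight makes `h` integrable on the whole strip, so that Fubini applies.
  set w : ℝ × ℝ → ℝ := fun p => h p * Real.exp (-|p.1|)
  have hw : Integrable w stripMeasure := hh.integrable_mul_exp_neg_abs_fst
  have hwk : ∀ k : ℕ, Integrable (fun p => w p * p.2 ^ k) stripMeasure := by
    intro k
    convert (hh.mul_snd_pow k).integrable_mul_exp_neg_abs_fst using 2 with p
    simp only [w]
    ring
  have hk : ∀ k : ℕ, ∀ᵐ x : ℝ, ∫ y in Icc (0 : ℝ) 1, w (x, y) * y ^ k = 0 := by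
    intro k
    have hm : Integrable fun x => ∫ y in Icc (0 : ℝ) 1, w (x, y) * y ^ k :=
      (hwk k).integral_prod_left
    -- The factor `exp |x|` undoes the weight. It multiplies the moment and not the test function,
    -- because it is not smooth at 0.
    have hloc : LocallyIntegrable
        fun x => (∫ y in Icc (0 : ℝ) 1, w (x, y) * y ^ k) * Real.exp |x| := by
      rw [← locallyIntegrableOn_univ]
      exact (locallyIntegrableOn_univ.2 hm.locallyIntegrable).mul_continuousOn
        (by fun_prop) isOpen_univ.isLocallyClosed
    have := ae_eq_zero_of_integral_contDiff_smul_eq_zero hloc fun g hg hgc => ?_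
    · filter_upwards [this] with x hx
      exact (mul_eq_zero.1 hx).resolve_right (Real.exp_ne_zero _)
    · have hi : Integrable (fun p : ℝ × ℝ => h p * p.2 ^ k * g p.1) stripMeasure :=
        integrable_mul_comp_of_hasCompactSupport (hh.mul_snd_pow k).1 measurable_fst
          (hh.mul_snd_pow k).integrable_mul_exp_neg_abs_fst hg.continuous hgc
      have h1 := H k g hg hgc
      rw [stripMeasure, integral_prod _ hi] at h1
      refine Eq.trans ?_ h1
      refine integral_congr_ae (ae_of_all _ fun x => ?_)
      simp only [smul_eq_mul]
      rw [← integral_mul_const, ← integral_const_mul]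
      refine integral_congr_ae (ae_of_all _ fun y => ?_)
      have : Real.exp (-|x|) * Real.exp |x| = 1 := by rw [← Real.exp_add]; simp
      simp only [w]
      linear_combination (g x * h (x, y) * y ^ k) * this
  have hw0 : w =ᵐ[stripMeasure] 0 := by
    have hint := hw.prod_right_ae
    have hs : ∀ᵐ x : ℝ, (fun y => w (x, y)) =ᵐ[volume.restrict (Icc (0 : ℝ) 1)] 0 := by
      filter_upwards [ae_all_iff.2 hk, hint] with x hx hxi
      exact ae_eq_zero_of_integral_mul_pow_eq_zero hxi hx
    have h1 : ∫ p, ‖w p‖ ∂stripMeasure = 0 := by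
      rw [stripMeasure, integral_prod _ hw.norm]
      refine integral_eq_zero_of_ae ?_
      filter_upwards [hs] with x hx
      refine integral_eq_zero_of_ae ?_
      filter_upwards [hx] with y hy
      simp [hy]
    have h2 := (integral_eq_zero_iff_of_nonneg (fun _ => norm_nonneg _) hw.norm).1 h1
    filter_upwards [h2] with p hp
    exact norm_eq_zero.1 hp
  filter_upwards [hw0] with p hp
  exact (mul_eq_zero.1 hp).resolve_right (Real.exp_ne_zero _)

theorem ae_eq_zero_of_integral_mul_sigmoid_sub_eq_zero {h : ℝ × ℝ → ℝ}
    (hh : MemLp h 2 stripMeasure)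
    (H : ∀ b c d l : ℝ, 1 ≤ l → ∫ p, h p * (Real.sigmoid (l * (p.1 + b * p.2 - c))
      - Real.sigmoid (l * (p.1 + b * p.2 - d))) ∂stripMeasure = 0) :
    h =ᵐ[stripMeasure] 0 := by
  refine ae_eq_zero_of_integral_mul_pow_mul_eq_zero hh fun k χ hχ hc =>
    integral_mul_pow_mul_eq_zero hh (fun u hu huc b => ?_) k hχ hc
  have hX : Measurable fun p : ℝ × ℝ => p.1 + b * p.2 := by fun_prop
  have hi := integrable_mul_exp_neg_abs_add (K := |b|) hh.1 measurable_fst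
    (measurable_snd.const_mul b) hh.integrable_mul_exp_neg_abs_fst (by
      filter_upwards [ae_stripMeasure_snd_mem] with p hp
      rw [abs_mul, abs_of_nonneg hp.1]
      exact mul_le_of_le_one_right (abs_nonneg b) hp.2)
  exact integral_mul_comp_eq_zero_of_unitStep hh.1 hX hi (fun c d =>
    integral_mul_unitStep_sub_eq_zero hh.1 hX hi fun l hl => H b c d l hl) (hu.of_le (by simp)) huc

/-! ### Density of logistic networks in L² of the strip -/

/-- The plane as a product of two lines. -/
noncomputable def planeEquiv : EuclideanSpace ℝ (Fin 2) ≃ᵐ ℝ × ℝ :=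
  (MeasurableEquiv.toLp 2 (Fin 2 → ℝ)).symm.trans MeasurableEquiv.finTwoArrow

theorem planeEquiv_apply (x : EuclideanSpace ℝ (Fin 2)) : planeEquiv x = (x 0, x 1) := rfl

theorem measurePreserving_planeEquiv :
    MeasurePreserving planeEquiv (volume.restrict strip) stripMeasure := by
  have h : MeasurePreserving planeEquiv volume volume :=
    (volume_preserving_finTwoArrow ℝ).comp
      (EuclideanSpace.volume_preserving_symm_measurableEquiv_toLp (Fin 2))
  have h2 := h.restrict_preimage (s := univ ×ˢ Icc (0 : ℝ) 1)
    (MeasurableSet.univ.prod measurableSet_Icc)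
  rw [Measure.volume_eq_prod, ← Measure.prod_restrict, Measure.restrict_univ] at h2
  have e : planeEquiv ⁻¹' univ ×ˢ Icc (0 : ℝ) 1 = strip := by
    ext x
    simp [strip, planeEquiv_apply]
  rwa [e] at h2

theorem shallowNetworks_add {n : ℕ} {ψ : ℝ → ℝ} {F G : EuclideanSpace ℝ (Fin n) → ℝ}
    (hF : F ∈ shallowNetworks n ψ) (hG : G ∈ shallowNetworks n ψ) :
    F + G ∈ shallowNetworks n ψ := by
  obtain ⟨k, t, y, θ, rfl⟩ := hF
  obtain ⟨k', t', y', θ', rfl⟩ := hG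
  exact ⟨k + k', Fin.append t t', Fin.append y y', Fin.append θ θ', by simp [Fin.sum_univ_add]⟩

theorem shallowNetworks_smul {n : ℕ} {ψ : ℝ → ℝ} {F : EuclideanSpace ℝ (Fin n) → ℝ} (a : ℝ)
    (hF : F ∈ shallowNetworks n ψ) : a • F ∈ shallowNetworks n ψ := by
  obtain ⟨k, t, y, θ, rfl⟩ := hF
  exact ⟨k, fun i => a * t i, y, θ, by simp [Finset.smul_sum, mul_smul]⟩

theorem zero_mem_shallowNetworks (n : ℕ) (ψ : ℝ → ℝ) : 0 ∈ shallowNetworks n ψ :=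
  ⟨0, Fin.elim0, Fin.elim0, Fin.elim0, by simp⟩

/-- The square integrable functions on the strip represented by logistic shallow networks. -/
noncomputable def networkSubmodule : Submodule ℝ (Lp ℝ 2 (volume.restrict strip)) where
  carrier := {F | ∃ G ∈ shallowNetworks 2 Real.sigmoid, ⇑F =ᵐ[volume.restrict strip] G}
  add_mem' := by
    rintro F F' ⟨G, hG, hFG⟩ ⟨G', hG', hFG'⟩
    exact ⟨G + G', shallowNetworks_add hG hG', (Lp.coeFn_add F F').trans (hFG.add hFG')⟩
  zero_mem' := ⟨0, zero_mem_shallowNetworks _ _, Lp.coeFn_zero _ _ _⟩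
  smul_mem' := by
    rintro a F ⟨G, hG, hFG⟩
    exact ⟨a • G, shallowNetworks_smul a hG, (Lp.coeFn_smul a F).trans (hFG.const_smul a)⟩

theorem sigmoid_sub_sigmoid_mem_shallowNetworks (b c d l : ℝ) :
    (fun x : EuclideanSpace ℝ (Fin 2) => Real.sigmoid (l * (x 0 + b * x 1 - c))
      - Real.sigmoid (l * (x 0 + b * x 1 - d))) ∈ shallowNetworks 2 Real.sigmoid := by
  refine ⟨2, ![1, -1], fun _ => !₂[l, l * b], ![-(l * c), -(l * d)], ?_⟩
  ext x
  have e : ∀ z, l * (x 0 + b * x 1 - z) = x 0 * l + x 1 * (l * b) + -(l * z) := fun z => by ring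
  simp only [e]
  simp [Fin.sum_univ_two, ridgeFunction, realTranslate, PiLp.inner_apply, sub_eq_add_neg]

theorem memLp_sigmoid_sub_sigmoid (b c d : ℝ) {l : ℝ} (hl : 1 ≤ l) :
    MemLp (fun p : ℝ × ℝ => Real.sigmoid (l * (p.1 + b * p.2 - c))
      - Real.sigmoid (l * (p.1 + b * p.2 - d))) 2 stripMeasure := by
  refine (memLp_exp_neg_abs_fst.const_mul
    (Real.exp (max |c| |d|) * Real.exp |b|)).mono' ?_ ?_
  · have := continuous_sigmoid.measurable
    exact Measurable.aestronglyMeasurable (by fun_prop)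
  · filter_upwards [ae_stripMeasure_snd_mem] with p hp
    refine (abs_sigmoid_sub_sigmoid_le (le_max_left _ _) (le_max_right _ _) hl).trans ?_
    rw [mul_assoc]
    refine mul_le_mul_of_nonneg_left ((exp_neg_abs_add_le _ _).trans ?_) (Real.exp_pos _).le
    refine mul_le_mul_of_nonneg_right (Real.exp_le_exp.2 ?_) (Real.exp_pos _).le
    rw [abs_mul, abs_of_nonneg hp.1]
    exact mul_le_of_le_one_right (abs_nonneg b) hp.2

/-- In a Hilbert space a subspace is dense when its orthogonal complement is trivial; testing
against logistic differences already forces this. -/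
theorem networkSubmodule_topologicalClosure : networkSubmodule.topologicalClosure = ⊤ := by
  rw [Submodule.topologicalClosure_eq_top_iff, Submodule.eq_bot_iff]
  intro h hh
  have hsymm := measurePreserving_planeEquiv.symm planeEquiv
  have hh' : MemLp (h ∘ planeEquiv.symm) 2 stripMeasure :=
    (Lp.memLp h).comp_measurePreserving hsymm
  have h0 : h ∘ planeEquiv.symm =ᵐ[stripMeasure] 0 := by
    refine ae_eq_zero_of_integral_mul_sigmoid_sub_eq_zero hh' fun b c d l hl => ?_
    have hG : MemLp _ 2 (volume.restrict strip) :=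
      (memLp_sigmoid_sub_sigmoid b c d hl).comp_measurePreserving measurePreserving_planeEquiv
    have h1 := hh (hG.toLp _)
      ⟨_, sigmoid_sub_sigmoid_mem_shallowNetworks b c d l, hG.coeFn_toLp⟩
    rw [L2.inner_def] at h1
    rw [← measurePreserving_planeEquiv.integral_comp', ← h1]
    refine integral_congr_ae ?_
    filter_upwards [hG.coeFn_toLp] with x hx
    rw [hx]
    simp [planeEquiv_apply (x := x) ▸ planeEquiv.symm_apply_apply x, planeEquiv_apply]
  rw [Lp.eq_zero_iff_ae_eq_zero]
  filter_upwards [measurePreserving_planeEquiv.quasiMeasurePreserving.ae h0] with x hx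
  rwa [Function.comp_apply, planeEquiv.symm_apply_apply] at hx

theorem mem_closure_shallowNetworks (F : Lp ℝ 2 (volume.restrict strip)) :
    F ∈ closure {F : Lp ℝ 2 (volume.restrict strip) |
      ∃ G ∈ shallowNetworks 2 Real.sigmoid, ⇑F =ᵐ[volume.restrict strip] G} := by
  have : F ∈ networkSubmodule.topologicalClosure :=
    networkSubmodule_topologicalClosure ▸ Submodule.mem_top
  exact this

/-! ### Tails of the normal distribution -/

theorem integrable_exp_neg_sq_div_two : Integrable fun t : ℝ => Real.exp (-t ^ 2 / 2) := by
  convert integrable_exp_neg_mul_sq (b := 1 / 2) (by norm_num) using 3 with t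
  ring

theorem integral_exp_neg_sq_div_two :
    ∫ t : ℝ, Real.exp (-t ^ 2 / 2) = Real.sqrt (2 * Real.pi) := by
  convert integral_gaussian (1 / 2) using 4 <;> ring

theorem one_sub_normalCDF (x : ℝ) :
    1 - normalCDF x = 1 / Real.sqrt (2 * Real.pi) * ∫ t in Ioi x, Real.exp (-t ^ 2 / 2) := by
  have h := intervalIntegral.integral_Iic_add_Ioi (b := x)
    integrable_exp_neg_sq_div_two.integrableOn integrable_exp_neg_sq_div_two.integrableOn
  rw [integral_exp_neg_sq_div_two] at h
  have hpos : 0 < Real.sqrt (2 * Real.pi) := by positivity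
  rw [normalCDF, eq_sub_of_add_eq' h]
  field_simp

theorem normalCDF_nonneg (x : ℝ) : 0 ≤ normalCDF x :=
  mul_nonneg (by positivity) (integral_nonneg fun _ => (Real.exp_pos _).le)

theorem normalCDF_le_one (x : ℝ) : normalCDF x ≤ 1 := by
  have : 0 ≤ 1 - normalCDF x := by
    rw [one_sub_normalCDF]
    exact mul_nonneg (by positivity) (integral_nonneg fun _ => (Real.exp_pos _).le)
  linarith

theorem monotone_normalCDF : Monotone normalCDF := fun x y hxy =>
  mul_le_mul_of_nonneg_left (setIntegral_mono_set integrable_exp_neg_sq_div_two.integrableOn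
    (ae_of_all _ fun _ => (Real.exp_pos _).le) (Iic_subset_Iic.2 hxy).eventuallyLE) (by positivity)

/-- Chernoff's bound: `exp (m * (t - x)) ≥ 1` for `t > x`, and completing the square shows that the
tilted Gaussian is integrable. -/
theorem exists_one_sub_normalCDF_le {m : ℝ} (hm : 0 ≤ m) :
    ∃ C, 0 ≤ C ∧ ∀ x, 1 - normalCDF x ≤ C * Real.exp (-(m * x)) := by
  have hint : Integrable fun t : ℝ => Real.exp (m * t) * Real.exp (-t ^ 2 / 2) := by
    convert (integrable_exp_neg_sq_div_two.comp_sub_right m).const_mul (Real.exp (m ^ 2 / 2))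
      using 2 with t
    rw [← Real.exp_add, ← Real.exp_add]
    congr 1
    ring
  refine ⟨1 / Real.sqrt (2 * Real.pi) * ∫ t : ℝ, Real.exp (m * t) * Real.exp (-t ^ 2 / 2),
    mul_nonneg (by positivity) (integral_nonneg fun _ => by positivity), fun x => ?_⟩
  rw [one_sub_normalCDF, mul_assoc]
  refine mul_le_mul_of_nonneg_left ?_ (by positivity)
  rw [← integral_mul_const]
  refine le_trans ?_ (setIntegral_le_integral (s := Ioi x) (hint.mul_const _)
    (ae_of_all _ fun _ => by positivity))
  refine setIntegral_mono_on integrable_exp_neg_sq_div_two.integrableOn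
    (hint.mul_const _).integrableOn measurableSet_Ioi fun t ht => ?_
  rw [← Real.exp_add, ← Real.exp_add, Real.exp_le_exp]
  nlinarith [mem_Ioi.1 ht]

/-! ### Decay of the time value and growth of the price -/

section BlackScholes

variable {σ r q : ℝ}

theorem measurable_bsTimeValue : Measurable fun p : ℝ × ℝ => bsTimeValue σ r q p.1 p.2 := by
  have := monotone_normalCDF.measurable
  unfold bsTimeValue bsPrice intrinsicValue bsD1 bsD2
  refine Measurable.sub (Measurable.ite (measurable_snd (measurableSet_singleton 0)) ?_ ?_) ?_ <;>
    fun_prop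

theorem le_div_mul_sqrt {σ a b τ : ℝ} (hσ : 0 < σ) (hτ : 0 < τ) (hτ1 : τ ≤ 1) (ha : 0 ≤ a)
    (hab : a ≤ b) : a / σ ≤ b / (σ * Real.sqrt τ) := by
  have h1 : Real.sqrt τ ≤ 1 := Real.sqrt_le_one.2 hτ1
  have h2 : 0 < Real.sqrt τ := Real.sqrt_pos.2 hτ
  exact div_le_div₀ (ha.trans hab) hab (by positivity) (mul_le_of_le_one_right hσ.le h1)

theorem exp_neg_mul_le_exp_abs (r : ℝ) {τ : ℝ} (hτ : 0 ≤ τ) (hτ1 : τ ≤ 1) :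
    Real.exp (-r * τ) ≤ Real.exp |r| := by
  rw [Real.exp_le_exp]
  nlinarith [neg_abs_le r, abs_nonneg r]

/-- For `s ≤ S` every term is bounded. For `s ≥ S` the intrinsic value is `s E - D`, so the time
value is `D (1 - N(d₂)) - s E (1 - N(d₁))`, and both tails are `O(s⁻³)`. -/
theorem exists_abs_bsTimeValue_le (hσ : 0 < σ) (hq : 0 ≤ q) :
    ∃ A, 0 ≤ A ∧ ∀ s τ : ℝ, 0 < s → 0 ≤ τ → τ ≤ 1 →
      |bsTimeValue σ r q s τ| ≤ A * (1 + s ^ 2)⁻¹ := by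
  -- Since `d₁, d₂ ≥ (log s - c₀) / σ`, the rate `3σ` turns the tail bound into `s⁻³`; the factor
  -- `s` in the price leaves `s⁻²`.
  obtain ⟨C, hC0, hC⟩ := exists_one_sub_normalCDF_le (m := 3 * σ) (by positivity)
  -- `c₀` dominates the drifts `r - q` and `r - q ± σ² / 2` in absolute value, so `log s ≥ c₀` makes
  -- the numerators of `d₁` and `d₂` nonnegative.
  set c₀ := |r| + q + σ ^ 2 / 2
  have hc₀ : 0 ≤ c₀ := by positivity
  set S := Real.exp c₀
  set A₁ := 2 * (S + Real.exp |r|) * (1 + S ^ 2)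
  set A₂ := 2 * ((1 + Real.exp |r|) * (C * Real.exp (3 * c₀)))
  have hA₁ : 0 ≤ A₁ := by positivity
  have hA₂ : 0 ≤ A₂ := by positivity
  refine ⟨A₁ + A₂, by positivity, fun s τ hs hτ hτ1 => ?_⟩
  rw [← div_eq_mul_inv, le_div_iff₀ (by positivity)]
  rcases hτ.eq_or_lt with rfl | hτ
  · simpa [bsTimeValue, bsPrice, intrinsicValue] using add_nonneg hA₁ hA₂
  have hE0 := Real.exp_pos (-q * τ)
  have hE1 : Real.exp (-q * τ) ≤ 1 := Real.exp_le_one_iff.2 (by nlinarith)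
  have hD0 := Real.exp_pos (-r * τ)
  have hD1 := exp_neg_mul_le_exp_abs r hτ.le hτ1
  simp only [bsTimeValue, bsPrice, intrinsicValue, hτ.ne', if_false]
  set E := Real.exp (-q * τ)
  set D := Real.exp (-r * τ)
  have hN1 := normalCDF_nonneg (bsD1 σ r q s τ)
  have hN1' := normalCDF_le_one (bsD1 σ r q s τ)
  have hN2 := normalCDF_nonneg (bsD2 σ r q s τ)
  have hN2' := normalCDF_le_one (bsD2 σ r q s τ)
  have hsE : s * E ≤ s := mul_le_of_le_one_right hs.le hE1
  have hsE0 : 0 < s * E := by positivity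
  rcases le_total s S with hsS | hsS
  · have h1 : s * E * normalCDF (bsD1 σ r q s τ) ≤ s * E := mul_le_of_le_one_right hsE0.le hN1'
    have h2 : D * normalCDF (bsD2 σ r q s τ) ≤ D := mul_le_of_le_one_right hD0.le hN2'
    have h3 := mul_nonneg hsE0.le hN1
    have h4 := mul_nonneg hD0.le hN2
    have h5 : max 0 (s * E - D) ≤ s * E := max_le hsE0.le (by linarith)
    have h6 := le_max_left 0 (s * E - D)
    have hb : |s * E * normalCDF (bsD1 σ r q s τ) - D * normalCDF (bsD2 σ r q s τ)
        - max 0 (s * E - D)| ≤ 2 * (S + Real.exp |r|) := by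
      rw [abs_le]
      constructor <;> linarith
    calc _ ≤ 2 * (S + Real.exp |r|) * (1 + S ^ 2) := by gcongr
      _ ≤ A₁ + A₂ := by linarith
  · have hlog : c₀ ≤ Real.log s := (Real.le_log_iff_exp_le hs).2 hsS
    have hr := neg_abs_le r
    have hr' := le_abs_self r
    have hσ2 : 0 ≤ σ ^ 2 / 2 := by positivity
    have hr0 := abs_nonneg r
    have hdrift : ∀ z, -c₀ ≤ z → -c₀ ≤ z * τ := fun z hz => by nlinarith
    have hED : D ≤ s * E := by
      rw [← Real.exp_log hs, ← Real.exp_add, Real.exp_le_exp]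
      linarith [hdrift (r - q) (by simp only [c₀]; linarith)]
    have hd : ∀ d, (Real.log s - c₀) / σ ≤ d →
        1 - normalCDF d ≤ C * Real.exp (3 * c₀) / s ^ 3 := by
      intro d hd
      refine (hC d).trans ?_
      rw [mul_div_assoc]
      refine mul_le_mul_of_nonneg_left ?_ hC0
      rw [← Real.exp_log (pow_pos hs 3), ← Real.exp_sub, Real.exp_le_exp, Real.log_pow]
      rw [div_le_iff₀ hσ] at hd
      push_cast
      linarith
    have hd1 := hd (bsD1 σ r q s τ) (le_div_mul_sqrt hσ hτ hτ1 (by linarith)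
      (by linarith [hdrift (r - q + σ ^ 2 / 2) (by simp only [c₀]; linarith)]))
    have hd2 := hd (bsD2 σ r q s τ) (le_div_mul_sqrt hσ hτ hτ1 (by linarith)
      (by linarith [hdrift (r - q - σ ^ 2 / 2) (by simp only [c₀]; linarith)]))
    rw [max_eq_right (by linarith)]
    set B := C * Real.exp (3 * c₀) / s ^ 3
    have hB : 0 ≤ B := by positivity
    have hs1 : 1 ≤ s := (Real.one_le_exp hc₀).trans hsS
    have hb : |s * E * normalCDF (bsD1 σ r q s τ) - D * normalCDF (bsD2 σ r q s τ)
        - (s * E - D)| ≤ (s + Real.exp |r|) * B := by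
      have h1 : s * E * (1 - normalCDF (bsD1 σ r q s τ)) ≤ s * B :=
        mul_le_mul hsE hd1 (by linarith) hs.le
      have h2 : D * (1 - normalCDF (bsD2 σ r q s τ)) ≤ Real.exp |r| * B :=
        mul_le_mul hD1 hd2 (by linarith) (Real.exp_pos _).le
      have h3 : 0 ≤ s * E * (1 - normalCDF (bsD1 σ r q s τ)) := mul_nonneg hsE0.le (by linarith)
      have h4 : 0 ≤ D * (1 - normalCDF (bsD2 σ r q s τ)) := mul_nonneg hD0.le (by linarith)
      have h5 : 0 ≤ s * B := by positivity
      have h6 : 0 ≤ Real.exp |r| * B := by positivity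
      rw [abs_le]
      constructor <;> linarith
    calc _ ≤ (s + Real.exp |r|) * B * (1 + s ^ 2) := by gcongr
      -- As `s ≥ 1`, all lower powers of `s` can be raised until they cancel the `s³` in `B`.
      _ ≤ (s + Real.exp |r| * s) * B * (s ^ 2 + s ^ 2) := by
        gcongr
        · exact le_mul_of_one_le_right (Real.exp_pos _).le hs1
        · exact one_le_pow₀ hs1
      _ = A₂ := by
        simp only [B, A₂]
        field_simp
        ring
      _ ≤ A₁ + A₂ := by linarith

theorem memLp_bsTimeValue (hσ : 0 < σ) (hq : 0 ≤ q) :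
    MemLp (extendByZero (bsTimeValue σ r q)) 2 (volume.restrict strip) := by
  obtain ⟨A, hA0, hA⟩ := exists_abs_bsTimeValue_le (r := r) hσ hq
  have hm : Measurable ({p : ℝ × ℝ | 0 < p.1}.indicator fun p => bsTimeValue σ r q p.1 p.2) :=
    measurable_bsTimeValue.indicator (measurableSet_lt measurable_const measurable_fst)
  have h1 : MemLp (fun p : ℝ × ℝ => (1 + p.1 ^ 2)⁻¹) 2 stripMeasure := by
    have hm : Measurable fun p : ℝ × ℝ => (1 + p.1 ^ 2)⁻¹ := by fun_prop
    rw [memLp_two_iff_integrable_sq hm.aestronglyMeasurable]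
    refine (integrable_comp_fst_stripMeasure integrable_inv_one_add_sq).mono'
      (hm.pow_const 2).aestronglyMeasurable (ae_of_all _ fun p => ?_)
    rw [Real.norm_of_nonneg (by positivity), sq]
    exact mul_le_of_le_one_left (by positivity) (inv_le_one_of_one_le₀ (by nlinarith [sq_nonneg p.1]))
  have h2 : MemLp ({p : ℝ × ℝ | 0 < p.1}.indicator fun p => bsTimeValue σ r q p.1 p.2) 2
      stripMeasure := by
    refine (h1.const_mul A).mono' hm.aestronglyMeasurable ?_
    filter_upwards [ae_stripMeasure_snd_mem] with p hp
    by_cases h : 0 < p.1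
    · rw [indicator_of_mem (show p ∈ {p : ℝ × ℝ | 0 < p.1} from h)]
      exact hA _ _ h hp.1 hp.2
    · rw [indicator_of_notMem (show p ∉ {p : ℝ × ℝ | 0 < p.1} from h), norm_zero]
      positivity
  exact h2.comp_measurePreserving measurePreserving_planeEquiv

theorem exists_abs_le_of_mem_shallowNetworks_sigmoid {n : ℕ} {G : EuclideanSpace ℝ (Fin n) → ℝ}
    (hG : G ∈ shallowNetworks n Real.sigmoid) : ∃ M, ∀ x, |G x| ≤ M := by
  obtain ⟨k, t, y, θ, rfl⟩ := hG
  refine ⟨∑ i, |t i|, fun x => ?_⟩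
  rw [Finset.sum_apply]
  refine (Finset.abs_sum_le_sum_abs _ _).trans (Finset.sum_le_sum fun i _ => ?_)
  rw [Pi.smul_apply, smul_eq_mul, abs_mul]
  refine mul_le_of_le_one_right (abs_nonneg _) ?_
  rw [ridgeFunction, realTranslate, abs_of_pos (Real.sigmoid_pos _)]
  exact Real.sigmoid_le_one _

theorem volume_restrict_strip_setOf_le (S : ℝ) :
    volume.restrict strip {x : EuclideanSpace ℝ (Fin 2) | S ≤ x 0} = ⊤ := by
  have h := measurePreserving_planeEquiv.measure_preimage
    (s := Ici S ×ˢ univ) (measurableSet_Ici.prod MeasurableSet.univ).nullMeasurableSet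
  rw [stripMeasure, Measure.prod_prod, Real.volume_Ici, measure_univ, mul_one] at h
  rw [← h]
  congr 1
  ext x
  simp [planeEquiv_apply]

/-- The price differs from the intrinsic value by at most `A`, and the intrinsic value is at least
`s * exp (-q) - exp |r|`. -/
theorem exists_forall_le_bsPrice (hσ : 0 < σ) (hq : 0 ≤ q) (K : ℝ) :
    ∃ S, 0 < S ∧ ∀ s τ : ℝ, S ≤ s → 0 ≤ τ → τ ≤ 1 → K ≤ bsPrice σ r q s τ := by
  obtain ⟨A, hA0, hA⟩ := exists_abs_bsTimeValue_le (r := r) hσ hq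
  have hlim : Tendsto (fun s : ℝ => s * Real.exp (-q)) atTop atTop :=
    tendsto_id.atTop_mul_const (Real.exp_pos _)
  obtain ⟨S, hS⟩ := eventually_atTop.1 (hlim.eventually_ge_atTop (K + Real.exp |r| + A))
  refine ⟨max S 1, by positivity, fun s τ hs hτ hτ1 => ?_⟩
  have hs0 : 0 < s := lt_of_lt_of_le (by positivity) hs
  have h1 := hS s ((le_max_left _ _).trans hs)
  have h2 : |bsTimeValue σ r q s τ| ≤ A := (hA s τ hs0 hτ hτ1).trans
    (mul_le_of_le_one_right hA0 (inv_le_one_of_one_le₀ (by nlinarith [sq_nonneg s])))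
  have h3 : s * Real.exp (-q) ≤ s * Real.exp (-q * τ) :=
    mul_le_mul_of_nonneg_left (Real.exp_le_exp.2 (by nlinarith)) hs0.le
  have h4 := exp_neg_mul_le_exp_abs r hτ hτ1
  have h5 : s * Real.exp (-q * τ) - Real.exp (-r * τ) ≤ intrinsicValue r q s τ := le_max_right _ _
  have h6 := (abs_le.1 h2).1
  rw [bsTimeValue] at h6
  linarith

/-- Where the price exceeds `M + 1`, the difference is at least 1; this contains a half-strip `s ≥
S`, of infinite measure. -/
theorem eLpNorm_sub_bsPrice_eq_top (hσ : 0 < σ) (hq : 0 ≤ q) {G : EuclideanSpace ℝ (Fin 2) → ℝ}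
    {M : ℝ} (hG : ∀ x, |G x| ≤ M) :
    eLpNorm (G - extendByZero (bsPrice σ r q)) 2 (volume.restrict strip) = ⊤ := by
  obtain ⟨S, hS0, hS⟩ := exists_forall_le_bsPrice (r := r) hσ hq (M + 1)
  have hm : MeasurableSet {x : EuclideanSpace ℝ (Fin 2) | S ≤ x 0} :=
    measurableSet_le measurable_const (by fun_prop)
  have hstrip : MeasurableSet strip :=
    (by fun_prop : Measurable fun x : EuclideanSpace ℝ (Fin 2) => x 1) measurableSet_Icc
  have htop : eLpNorm ({x : EuclideanSpace ℝ (Fin 2) | S ≤ x 0}.indicator fun _ => (1 : ℝ)) 2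
      (volume.restrict strip) = ⊤ := by
    rw [eLpNorm_indicator_const hm (by simp) (by simp), volume_restrict_strip_setOf_le]
    simp
  rw [eq_top_iff, ← htop]
  refine eLpNorm_mono_ae ?_
  filter_upwards [ae_restrict_mem hstrip] with x hx
  by_cases hxS : S ≤ x 0
  · rw [indicator_of_mem (by exact hxS), norm_one, Pi.sub_apply, extendByZero,
      indicator_of_mem (by exact hS0.trans_le hxS)]
    have h1 := hS _ _ hxS hx.1 hx.2
    have h2 := (abs_le.1 (hG x)).2
    rw [Real.norm_eq_abs, abs_sub_comm]
    exact le_trans (by linarith) (le_abs_self _)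
  · rw [indicator_of_notMem (by exact hxS), norm_zero]
    exact norm_nonneg _

end BlackScholes

theorem mainTheorem3 (σ r q : ℝ) (hσ : 0 < σ) (hq : 0 ≤ q) :
    (∃ hg : MemLp (extendByZero (bsTimeValue σ r q)) 2 (volume.restrict strip),
      hg.toLp (extendByZero (bsTimeValue σ r q)) ∈
        closure {F : Lp ℝ 2 (volume.restrict strip) |
          ∃ G ∈ shallowNetworks 2 Real.sigmoid, ⇑F =ᵐ[volume.restrict strip] G}) ∧
    ¬ ∃ G ∈ shallowNetworks 2 Real.sigmoid,
      eLpNorm (G - extendByZero (bsPrice σ r q)) 2 (volume.restrict strip) < ⊤ := by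
  refine ⟨⟨memLp_bsTimeValue hσ hq, mem_closure_shallowNetworks _⟩, ?_⟩
  rintro ⟨G, hG, hlt⟩
  obtain ⟨M, hM⟩ := exists_abs_le_of_mem_shallowNetworks_sigmoid hG
  exact hlt.ne (eLpNorm_sub_bsPrice_eq_top hσ hq hM)
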